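/- **Setting.** Consider $x(t+1)=f(x(t),u(t),w(t))$ with $f:\mathbb R^n\times\mathbb R^m\times\mathbb R^q\to\mathbb R^n$, constraints $(x(t),u(t))\in\mathbb Z$, disturbances $w(t)\in\mathbb W$, and a parameterized feedback $u=\pi(x,v)$. Put $f_\pi(x,v,w)=f(x,\pi(x,v),w)$, $\mathbb Z_\pi=\{(x,v):(x,\pi(x,v))\in\mathbb Z\}$ and, for a set $\Omega\subseteq\mathbb R^n$, $\overline{\mathbb Z}=\{(z,v):(z+\epsilon,v)\in\mathbb Z_\pi\ \forall\epsilon\in\Omega\}$. Let $L:\mathbb R^n\times\mathbb R^m\to\mathbb R$ be continuous and $L_\pi(x,v)=L(x,\pi(x,v))$. The stage cost $\ell$ is, on $\mathbb Z_\pi$, one of $L_\pi(z,v)$, $\int_\Omega L_\pi(z+\epsilon,v)\,d\epsilon$, $\max_{\epsilon\in\Omega}L_\pi(z+\epsilon,v)$ (with the integral, respectively the maximum, existing). For sequences $z(\cdot),v(\cdot)$ let $J_T=\sum_{t=0}^{T-1}\ell(z(t),v(t))$ and $J_\infty=\limsup_{T\to\infty}J_T\in[-\infty,\infty]$. The nominal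 dynamics are $z(t+1)=f_\pi(z(t),v(t),0)$. For $N\ge1$, $z_0\in\mathbb R^n$, terminal cost $V_f:\mathbb R^n\to\mathbb R$ and terminal region $\mathbb X_f\subseteq\mathbb R^n$, let $V_N(z_0)$ be the minimum of $J_N+V_f(z(N))$ over nominal trajectories with $z(0)=z_0$, $(z(t),v(t))\in\overline{\mathbb Z}$ for $0\le t<N$, and $z(N)\in\mathbb X_f$; let $\mathbb X_N$ be the set of $z_0$ for which such a trajectory exists. Let $V_\infty(z_0)\in[-\infty,\infty]$ be the infimum of $J_\infty$ over nominal trajectories with $z(0)=z_0$ and $(z(t),v(t))\in\overline{\mathbb Z}$ for all $t\ge0$. Suppose that for all $N\ge1$ the minimum $V_N(z_0)$ is attained for every $z_0\in\mathbb X_N$, and fix minimizers $(z_N^*(\cdot;z_0),v_N^*(\cdot;z_0))$. Suppose also that, for all $N\ge1$ and all $x\in\mathbb X_N\oplus\Omega$, the problem of minimizing $V_N(z_0)$ over $z_0\in\mathbb X_N$ with $x\in\{z_0\}\oplus\Omega$ has a minimizer, and fix one, $z_0^*(x)$ (it depends on $N$). Put $\mathbb Z_{cl}(z)=\{z_0^*(x^+):x^+\in\{f_\pi(z,v_N^*(0;z),0)\}\oplus\Omega\}$.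 A *closed-loop nominal sequence* with horizon $N$ is a sequence $z_N(0|t)$, $t\ge0$, with $z_N(0|0)\in\mathbb X_N$ and $z_N(0|t+1)\in\mathbb Z_{cl}(z_N(0|t))$ for all $t$; put $v_N(0|t)=v_N^*(0;z_N(0|t))$. Such a sequence need not satisfy the nominal dynamics. A function $[0,\infty)\to[0,\infty)$ is in $\mathcal K_\infty$ if it is continuous, strictly increasing, unbounded and zero at $0$, and in $\mathcal L$ if it is continuous, strictly decreasing and tends to $0$ at infinity. **Assumptions.** 1. $\mathbb Z$ and $\mathbb W$ are compact and convex with nonempty interior, and $0\in\operatorname{int}\mathbb W$. 2. $\Omega$ is robust control invariant: it is compact, and $f_\pi(x,v,w)-f_\pi(z,v,0)\in\Omega$ whenever $x-z\in\Omega$, $(x,v)\in\mathbb Z_\pi$, $w\in\mathbb W$. Both $\Omega$ and $\overline{\mathbb Z}$ have nonempty interior, and $\overline{\mathbb Z}\subseteq\mathbb Z_\pi$ (automatic if $0\in\Omega$). 3. $\ell$ is Lipschitz continuous on $\mathbb Z_\pi$. 4. $(z_s,v_s)$ minimizes $\ell$ over $\{(z,v)\in\overline{\mathbb Z}: z=f_\pi(z,v,0)\}$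 and lies in the interior of $\overline{\mathbb Z}$. 5. $\mathbb X_f$ is closed, $z_s\in\operatorname{int}\mathbb X_f$, $V_f$ is continuous on $\mathbb X_f$, and there is $\kappa_f:\mathbb X_f\to\mathbb R^m$ such that for all $z\in\mathbb X_f$: $(z,\kappa_f(z))\in\overline{\mathbb Z}$, $f_\pi(z,\kappa_f(z),0)\in\mathbb X_f$, and $V_f(f_\pi(z,\kappa_f(z),0))-V_f(z)\le-\ell(z,\kappa_f(z))+\ell(z_s,v_s)$. 6. There are $\alpha_\ell\in\mathcal K_\infty$ and a bounded $\lambda:\mathbb R^n\to\mathbb R$ such that $\lambda(z^+)-\lambda(z)\le\ell(z,v)-\ell(z_s,v_s)-\alpha_\ell(\|(z,v)-(z_s,v_s)\|)$ holds (a) for all $(z,v)\in\overline{\mathbb Z}$ with $z^+=f_\pi(z,v,0)$, and (b) for all $N\ge1$, $z\in\mathbb X_N$, $v=v_N^*(0;z)$ and all $z^+\in\mathbb Z_{cl}(z)$. 7. Exponential reachability: there are $c\ge0$ and $\rho\in[0,1)$ such that for every $z_0\in\bigcup_{N\ge1}\mathbb X_N$ some nominal trajectory with $z(0)=z_0$ satisfies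 $(z(t),v(t))\in\overline{\mathbb Z}$ and $\|(z(t),v(t))-(z_s,v_s)\|\le c\rho^t$ for all $t\ge0$. 8. Local $M$-step controllability: for some $M\ge1$ and all $\varepsilon>0$ there is $\delta>0$ such that any $y,y'$ with $\|y-z_s\|,\|y'-z_s\|\le\delta$ are joined by a nominal trajectory with $z(0)=y$, $z(M)=y'$ and $\|(z(t),v(t))-(z_s,v_s)\|\le\varepsilon$ for $0\le t<M$. 9. There is $\alpha_V\in\mathcal K_\infty$ with $|V_N(z)-V_N(z_s)|\le\alpha_V(\|z-z_s\|)$ for all $N\ge1$ and $z\in\mathbb X_N$. **Theorem.** There is $\delta_1\in\mathcal L$ such that for every $N\ge1$ and every closed-loop nominal sequence with horizon $N$ (in particular for every initial state $z_N(0|0)\in\mathbb X_N$), $$\limsup_{T\to\infty}\sum_{t=0}^{T-1}\ell(z_N(0|t),v_N(0|t))\ \le\ V_\infty(z_N(0|0))+\delta_1(N)$$ in $[-\infty,\infty]$. Moreover, if $\ell(z_s,v_s)=0$ (which can be achieved by subtracting a constant from $\ell$), then $V_\infty$ is finite on $\mathbb X_N$ for every $N\ge1$. -/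

import Mathlib

open Filter Topology MeasureTheory
open scoped NNReal

namespace TubeEMPC

/-- Class `𝓚∞`: continuous, strictly increasing, unbounded, zero at zero. -/
def ClassKInf (α : ℝ≥0 → ℝ≥0) : Prop :=
  Continuous α ∧ StrictMono α ∧ α 0 = 0 ∧ ∀ B : ℝ≥0, ∃ s, B ≤ α s

/-- Class `𝓛`: continuous, strictly decreasing, tending to zero at infinity. -/
def ClassL (δ : ℝ≥0 → ℝ≥0) : Prop :=
  Continuous δ ∧ StrictAnti δ ∧ Tendsto δ atTop (𝓝 0)

/-- The data of a tube-based economic MPC problem with terminal conditions (no properties). Pairs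
live in the product of two Euclidean spaces; its norm, the maximum of the two Euclidean norms, is
equivalent to the Euclidean one, and every condition below is invariant under this change. -/
structure Problem (n m q : ℕ) where
  /-- state transition map `f(x, u, w)` -/
  f : EuclideanSpace ℝ (Fin n) → EuclideanSpace ℝ (Fin m) → EuclideanSpace ℝ (Fin q) →
    EuclideanSpace ℝ (Fin n)
  /-- state and input constraint set -/
  ZZ : Set (EuclideanSpace ℝ (Fin n) × EuclideanSpace ℝ (Fin m))
  /-- disturbance set -/
  WW : Set (EuclideanSpace ℝ (Fin q))
  /-- parameterized feedback `u = π(x, v)` -/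
  fb : EuclideanSpace ℝ (Fin n) → EuclideanSpace ℝ (Fin m) → EuclideanSpace ℝ (Fin m)
  /-- robust control invariant set -/
  Ω : Set (EuclideanSpace ℝ (Fin n))
  /-- economic cost `L(x, u)` -/
  L : EuclideanSpace ℝ (Fin n) → EuclideanSpace ℝ (Fin m) → ℝ
  /-- stage cost of the nominal optimal control problem -/
  ℓ : EuclideanSpace ℝ (Fin n) × EuclideanSpace ℝ (Fin m) → ℝ
  /-- terminal cost -/
  Vf : EuclideanSpace ℝ (Fin n) → ℝ
  /-- terminal region -/
  Xf : Set (EuclideanSpace ℝ (Fin n))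
  /-- state of the robust optimal steady state -/
  zs : EuclideanSpace ℝ (Fin n)
  /-- artificial input of the robust optimal steady state -/
  vs : EuclideanSpace ℝ (Fin m)

namespace Problem

variable {n m q : ℕ} (P : Problem n m q)

/-- `f_π(x, v, w) = f(x, π(x, v), w)`. -/
def fpi (x : EuclideanSpace ℝ (Fin n)) (v : EuclideanSpace ℝ (Fin m))
    (w : EuclideanSpace ℝ (Fin q)) : EuclideanSpace ℝ (Fin n) :=
  P.f x (P.fb x v) w

/-- `ℤ_π = {(x, v) | (x, π(x, v)) ∈ ℤ}`. -/
def Zpi : Set (EuclideanSpace ℝ (Fin n) × EuclideanSpace ℝ (Fin m)) :=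
  {p | (p.1, P.fb p.1 p.2) ∈ P.ZZ}

/-- The tightened constraint set. -/
def Zbar : Set (EuclideanSpace ℝ (Fin n) × EuclideanSpace ℝ (Fin m)) :=
  {p | ∀ e ∈ P.Ω, (p.1 + e, p.2) ∈ P.Zpi}

/-- `L_π(x, v) = L(x, π(x, v))`. -/
def Lpi (x : EuclideanSpace ℝ (Fin n)) (v : EuclideanSpace ℝ (Fin m)) : ℝ :=
  P.L x (P.fb x v)

/-! ### Optimal control problems -/

/-- Trajectories admissible for the first `N` steps, starting at `z₀`. -/
def Admissible (N : ℕ) (z₀ : EuclideanSpace ℝ (Fin n))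
    (z : ℕ → EuclideanSpace ℝ (Fin n)) (v : ℕ → EuclideanSpace ℝ (Fin m)) : Prop :=
  z 0 = z₀ ∧ ∀ t < N, z (t + 1) = P.fpi (z t) (v t) 0 ∧ (z t, v t) ∈ P.Zbar

/-- Trajectories admissible for all times, starting at `z₀`. -/
def AdmissibleInf (z₀ : EuclideanSpace ℝ (Fin n))
    (z : ℕ → EuclideanSpace ℝ (Fin n)) (v : ℕ → EuclideanSpace ℝ (Fin m)) : Prop :=
  z 0 = z₀ ∧ ∀ t, z (t + 1) = P.fpi (z t) (v t) 0 ∧ (z t, v t) ∈ P.Zbar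

/-- Feasibility for the OCP with terminal conditions and horizon `N`. -/
def Feasible (N : ℕ) (z₀ : EuclideanSpace ℝ (Fin n))
    (z : ℕ → EuclideanSpace ℝ (Fin n)) (v : ℕ → EuclideanSpace ℝ (Fin m)) : Prop :=
  P.Admissible N z₀ z v ∧ z N ∈ P.Xf

/-- The cost accumulated over `N` steps. -/
noncomputable def J (N : ℕ) (z : ℕ → EuclideanSpace ℝ (Fin n))
    (v : ℕ → EuclideanSpace ℝ (Fin m)) : ℝ :=
  ∑ t ∈ Finset.range N, P.ℓ (z t, v t)

/-- Infinite horizon cost `limsup_N J_N`, in the extended reals. -/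
noncomputable def Jinf (z : ℕ → EuclideanSpace ℝ (Fin n))
    (v : ℕ → EuclideanSpace ℝ (Fin m)) : EReal :=
  limsup (fun N : ℕ => ((P.J N z v : ℝ) : EReal)) atTop

/-- The set of initial nominal states feasible for horizon `N`. -/
def XN (N : ℕ) : Set (EuclideanSpace ℝ (Fin n)) :=
  {z₀ | ∃ z v, P.Feasible N z₀ z v}

/-- Optimal value `V_N` of the OCP with terminal conditions. It is only used on `XN N`, where a
minimizer exists by `IsOptimalSelection`. -/
noncomputable def V (N : ℕ) (z₀ : EuclideanSpace ℝ (Fin n)) : ℝ :=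
  sInf {c | ∃ z v, P.Feasible N z₀ z v ∧ c = P.J N z v + P.Vf (z N)}

/-- Optimal value `V_∞` of the infinite horizon OCP, in the extended reals. -/
noncomputable def Vinf (z₀ : EuclideanSpace ℝ (Fin n)) : EReal :=
  sInf {c | ∃ z v, P.AdmissibleInf z₀ z v ∧ c = P.Jinf z v}

/-- `zopt N z₀`, `vopt N z₀` are minimizers of the OCP with horizon `N` and initial state `z₀`, for
every horizon and every feasible initial state. -/
def IsOptimalSelection (zopt : ℕ → EuclideanSpace ℝ (Fin n) → ℕ → EuclideanSpace ℝ (Fin n))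
    (vopt : ℕ → EuclideanSpace ℝ (Fin n) → ℕ → EuclideanSpace ℝ (Fin m)) : Prop :=
  ∀ N, 1 ≤ N → ∀ z₀ ∈ P.XN N,
    P.Feasible N z₀ (zopt N z₀) (vopt N z₀) ∧
    ∀ z v, P.Feasible N z₀ z v →
      P.J N (zopt N z₀) (vopt N z₀) + P.Vf (zopt N z₀ N) ≤ P.J N z v + P.Vf (z N)

/-- `ini N x` is a minimizer `z₀*(x)` of `V_N(z₀)` over the feasible `z₀` with `x ∈ {z₀} ⊕ Ω`,
for every horizon and every `x` for which this problem is feasible. -/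
def IsOptimalInitial (ini : ℕ → EuclideanSpace ℝ (Fin n) → EuclideanSpace ℝ (Fin n)) : Prop :=
  ∀ N, 1 ≤ N → ∀ x, (∃ z₀ ∈ P.XN N, x - z₀ ∈ P.Ω) →
    (ini N x ∈ P.XN N ∧ x - ini N x ∈ P.Ω) ∧
    ∀ z₀ ∈ P.XN N, x - z₀ ∈ P.Ω → P.V N (ini N x) ≤ P.V N z₀

/-- The set of all possible next nominal states: `z₀*(x⁺)` for
`x⁺ ∈ {f_π(z, v_N(0; z), 0)} ⊕ Ω`. -/
def Zcl (vopt : ℕ → EuclideanSpace ℝ (Fin n) → ℕ → EuclideanSpace ℝ (Fin m))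
    (ini : ℕ → EuclideanSpace ℝ (Fin n) → EuclideanSpace ℝ (Fin n))
    (N : ℕ) (z : EuclideanSpace ℝ (Fin n)) : Set (EuclideanSpace ℝ (Fin n)) :=
  {z' | ∃ e ∈ P.Ω, z' = ini N (P.fpi z (vopt N z 0) 0 + e)}

/-- Closed-loop nominal sequences `z(t) = z_N(0|t)` of the MPC scheme with horizon `N`. They need
not be trajectories of the nominal system. -/
def IsClosedLoop (vopt : ℕ → EuclideanSpace ℝ (Fin n) → ℕ → EuclideanSpace ℝ (Fin m))
    (ini : ℕ → EuclideanSpace ℝ (Fin n) → EuclideanSpace ℝ (Fin n))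
    (N : ℕ) (z : ℕ → EuclideanSpace ℝ (Fin n)) : Prop :=
  z 0 ∈ P.XN N ∧ ∀ t, z (t + 1) ∈ P.Zcl vopt ini N (z t)

/-- Infinite horizon closed-loop performance, the `limsup` over `T` of
`∑_{t < T} ℓ(z_N(0|t), v_N(0|t))`. -/
noncomputable def JclInf
    (vopt : ℕ → EuclideanSpace ℝ (Fin n) → ℕ → EuclideanSpace ℝ (Fin m))
    (N : ℕ) (z : ℕ → EuclideanSpace ℝ (Fin n)) : EReal :=
  P.Jinf z (fun t => vopt N (z t) 0)

/-! ### Assumptions -/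

/-- The constraint sets are compact and convex with nonempty interior, and the disturbance set
contains the origin in its interior. -/
def ConstraintSets : Prop :=
  (IsCompact P.ZZ ∧ Convex ℝ P.ZZ ∧ (interior P.ZZ).Nonempty) ∧
  (IsCompact P.WW ∧ Convex ℝ P.WW ∧ (interior P.WW).Nonempty) ∧
  0 ∈ interior P.WW

/-- `Ω` is robust control invariant for the error system under the feedback `π`. -/
def IsRCI : Prop :=
  IsCompact P.Ω ∧
  ∀ x z v, x - z ∈ P.Ω → (x, v) ∈ P.Zpi →
    ∀ w ∈ P.WW, P.fpi x v w - P.fpi z v 0 ∈ P.Ω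

/-- `Ω` is an RCI set, and it and the tightened constraint set have nonempty interior. The
tightened set is indeed a tightening of `ℤ_π` (which is automatic if `0 ∈ Ω`), so that the stage
cost is defined on it. -/
def RCIAssumption : Prop :=
  P.IsRCI ∧ (interior P.Ω).Nonempty ∧ (interior P.Zbar).Nonempty ∧ P.Zbar ⊆ P.Zpi

/-- The stage cost is one of `L_π`, `L_π^int` and `L_π^max` on `ℤ_π`. -/
def IsStageCost : Prop :=
  (∀ p ∈ P.Zpi, P.ℓ p = P.Lpi p.1 p.2) ∨
  (∀ p ∈ P.Zpi, IntegrableOn (fun e => P.Lpi (p.1 + e) p.2) P.Ω ∧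
    P.ℓ p = ∫ e in P.Ω, P.Lpi (p.1 + e) p.2) ∨
  (∀ p ∈ P.Zpi, IsGreatest ((fun e => P.Lpi (p.1 + e) p.2) '' P.Ω) (P.ℓ p))

/-- `L` is continuous, the stage cost is built from it, and it is Lipschitz on `ℤ_π`. -/
def StageCostAssumption : Prop :=
  Continuous (fun p : EuclideanSpace ℝ (Fin n) × EuclideanSpace ℝ (Fin m) => P.L p.1 p.2) ∧
  P.IsStageCost ∧ ∃ κ : ℝ≥0, 0 < κ ∧ LipschitzOnWith κ P.ℓ P.Zpi

/-- `(zs, vs)` minimizes the stage cost over the admissible steady states and lies in the interior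
of the tightened constraint set. -/
def ROSSAssumption : Prop :=
  P.zs = P.fpi P.zs P.vs 0 ∧
  (∀ z v, (z, v) ∈ P.Zbar → z = P.fpi z v 0 → P.ℓ (P.zs, P.vs) ≤ P.ℓ (z, v)) ∧
  (P.zs, P.vs) ∈ interior P.Zbar

/-- Terminal region, terminal cost and local auxiliary controller. -/
def TerminalAssumption : Prop :=
  IsClosed P.Xf ∧ P.zs ∈ interior P.Xf ∧ ContinuousOn P.Vf P.Xf ∧
  ∃ κf : EuclideanSpace ℝ (Fin n) → EuclideanSpace ℝ (Fin m), ∀ z ∈ P.Xf,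
    (z, κf z) ∈ P.Zbar ∧ P.fpi z (κf z) 0 ∈ P.Xf ∧
    P.Vf (P.fpi z (κf z) 0) - P.Vf z ≤ -P.ℓ (z, κf z) + P.ℓ (P.zs, P.vs)

/-- Strict dissipativity of the nominal system with respect to the supply rate
`ℓ(z, v) - ℓ(zs, vs)`, with bounded storage function `lam`. -/
def StrictlyDissipative (lam : EuclideanSpace ℝ (Fin n) → ℝ) (α : ℝ≥0 → ℝ≥0) : Prop :=
  ClassKInf α ∧ (∃ B : ℝ, ∀ z, |lam z| ≤ B) ∧
  ∀ z v, (z, v) ∈ P.Zbar →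
    lam (P.fpi z v 0) - lam z ≤
      P.ℓ (z, v) - P.ℓ (P.zs, P.vs) - (α ‖(z, v) - (P.zs, P.vs)‖₊ : ℝ)

/-- The dissipation inequality along all possible closed-loop transitions. -/
def StronglyDissipative
    (vopt : ℕ → EuclideanSpace ℝ (Fin n) → ℕ → EuclideanSpace ℝ (Fin m))
    (ini : ℕ → EuclideanSpace ℝ (Fin n) → EuclideanSpace ℝ (Fin n))
    (lam : EuclideanSpace ℝ (Fin n) → ℝ) (α : ℝ≥0 → ℝ≥0) : Prop :=
  ∀ N, 1 ≤ N → ∀ z ∈ P.XN N, ∀ z' ∈ P.Zcl vopt ini N z,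
    lam z' - lam z ≤
      P.ℓ (z, vopt N z 0) - P.ℓ (P.zs, P.vs) -
        (α ‖(z, vopt N z 0) - (P.zs, P.vs)‖₊ : ℝ)

/-- Dissipativity and strong dissipativity, with the same storage function and the same `α`. -/
def DissipativityAssumption
    (vopt : ℕ → EuclideanSpace ℝ (Fin n) → ℕ → EuclideanSpace ℝ (Fin m))
    (ini : ℕ → EuclideanSpace ℝ (Fin n) → EuclideanSpace ℝ (Fin n)) : Prop :=
  ∃ lam α, P.StrictlyDissipative lam α ∧ P.StronglyDissipative vopt ini lam α

/-- Exponential reachability of the steady state from all feasible initial states, with uniform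
constants. -/
def ExponentiallyReachable : Prop :=
  ∃ c ρ : ℝ, 0 ≤ c ∧ 0 ≤ ρ ∧ ρ < 1 ∧
    ∀ N, 1 ≤ N → ∀ z₀ ∈ P.XN N, ∃ z v, P.AdmissibleInf z₀ z v ∧
      ∀ t, ‖(z t, v t) - (P.zs, P.vs)‖ ≤ c * ρ ^ t

/-- Local `M`-step controllability at `(zs, vs)`: any two states close to `zs` are joined by an
`M`-step trajectory of the nominal system whose states and inputs stay close to `(zs, vs)`. -/
def LocallyControllable : Prop :=
  ∃ M : ℕ, 1 ≤ M ∧ ∀ ε > 0, ∃ δ > 0, ∀ y y',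
    ‖y - P.zs‖ ≤ δ → ‖y' - P.zs‖ ≤ δ →
    ∃ (z : ℕ → EuclideanSpace ℝ (Fin n)) (v : ℕ → EuclideanSpace ℝ (Fin m)),
      z 0 = y ∧ z M = y' ∧
      ∀ t < M, z (t + 1) = P.fpi (z t) (v t) 0 ∧ ‖(z t, v t) - (P.zs, P.vs)‖ ≤ ε

/-- Continuity of the optimal value functions at the steady state, uniformly in the horizon. -/
def ValueContinuity : Prop :=
  ∃ α : ℝ≥0 → ℝ≥0, ClassKInf α ∧ ∀ N, 1 ≤ N → ∀ z ∈ P.XN N,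
    |P.V N z - P.V N P.zs| ≤ (α ‖z - P.zs‖₊ : ℝ)

end Problem

end TubeEMPC

/-! Write `ℓ_s` for the steady-state cost. If `ℓ_s ≠ 0` the estimate is trivial. For `ℓ_s < 0` the
closed-loop cost drifts to `-∞` because `V_N` is bounded (`JclInf_eq_bot`). For `ℓ_s > 0`
dissipativity with a bounded storage function forces `V_∞ = ∞` (`Vinf_eq_top`).

Let `ℓ_s = 0`. The quantity between the two sides is `V_N(z₀) - V_N(z_s)`.

Closed loop (`JclInf_le`): along any closed-loop transition `V_N` drops by at least the stage cost,
so `J_T ≤ V_N(z(0)) - V_N(z(T))`. Strong dissipativity makes `z(T)` converge to `z_s`, and `V_N` is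
continuous there.

Infinite horizon (`exists_V_sub_le_Jinf`): by a turnpike argument, an infinite trajectory of bounded
cost is near `z_s` at some early time `k`, and the optimal trajectory from `z_s` is near `z_s` at
some later time `l`. Dynamic programming at these times, together with continuity of `V_N` and of
the storage function at `z_s`, gives `V_N(z₀) - V_N(z_s) ≤ J_∞ + 5η` for all large `N`, uniformly in
`z₀` and in the trajectory. The best error for each `N` is then dominated by an `𝓛`-function.

Finiteness of `V_∞`: the bounded storage function bounds it below, exponential reachability and the
Lipschitz stage cost bound it above. -/

namespace TubeEMPC

/-! ### Comparison functions of class `𝓛`. -/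

/-- A bounded null sequence is dominated by a function of class `𝓛`. -/
theorem exists_classL_ge (g : ℕ → ℝ) (K : ℝ) (hg0 : ∀ k, 0 ≤ g k) (hK : ∀ k, g k ≤ K)
    (hg : Tendsto g atTop (𝓝 0)) :
    ∃ δ : ℝ≥0 → ℝ≥0, ClassL δ ∧ ∀ k : ℕ, g k ≤ δ k := by
  have hK0 : 0 ≤ K := (hg0 0).trans (hK 0)
  -- A piecewise linear cutoff: `1` for `s ≤ k`, `0` for `s ≥ k + 1`. The supremum of the `g k * φ
  -- k` is antitone, `K`-Lipschitz, at least `g k` at `s = k`, and inherits the limit `0`.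
  let φ : ℕ → ℝ → ℝ := fun k s => max 0 (min 1 (k + 1 - s))
  have φ0 : ∀ k s, 0 ≤ φ k s := fun k s => le_max_left _ _
  have φ1 : ∀ k s, φ k s ≤ 1 := fun k s => max_le zero_le_one (min_le_left _ _)
  have φanti : ∀ k s t, s ≤ t → φ k t ≤ φ k s := fun k s t h => by
    simp only [φ]; gcongr
  have φlip : ∀ k s t, φ k s ≤ φ k t + |s - t| := fun k s t => by
    have h1 := neg_abs_le (s - t)
    have h2 := abs_nonneg (s - t)
    have h3 := φ0 k t
    refine max_le (by linarith) ?_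
    by_cases h : (1 : ℝ) ≤ k + 1 - t
    · have : φ k t = 1 := by simp only [φ]; rw [min_eq_left h]; simp
      rw [this]; exact (min_le_left _ _).trans (by linarith)
    · have : (k + 1 - t : ℝ) ≤ φ k t := by
        simp only [φ]; rw [min_eq_right (le_of_not_ge h)]; exact le_max_right _ _
      exact (min_le_right _ _).trans (by linarith)
  let D : ℝ → ℝ := fun s => ⨆ k, g k * φ k s
  have bdd : ∀ s, BddAbove (Set.range fun k => g k * φ k s) := fun s =>
    ⟨K, by
      rintro _ ⟨k, rfl⟩
      exact (mul_le_of_le_one_right (hg0 k) (φ1 k s)).trans (hK k)⟩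
  have D0 : ∀ s, 0 ≤ D s := fun s => Real.iSup_nonneg fun k => mul_nonneg (hg0 k) (φ0 k s)
  have Danti : ∀ s t, s ≤ t → D t ≤ D s := fun s t h =>
    ciSup_mono (bdd s) fun k => mul_le_mul_of_nonneg_left (φanti k s t h) (hg0 k)
  have Dlip : ∀ s t, D s ≤ D t + K * |s - t| := fun s t => by
    refine ciSup_le fun k => ?_
    calc g k * φ k s ≤ g k * (φ k t + |s - t|) := mul_le_mul_of_nonneg_left (φlip k s t) (hg0 k)
      _ = g k * φ k t + g k * |s - t| := by ring
      _ ≤ D t + K * |s - t| :=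
        add_le_add (le_ciSup (bdd t) k) (mul_le_mul_of_nonneg_right (hK k) (abs_nonneg _))
  have Dcont : Continuous D := (LipschitzWith.of_le_add_mul ⟨K, hK0⟩ Dlip).continuous
  have Dlim : Tendsto D atTop (𝓝 0) := by
    rw [Metric.tendsto_atTop]
    intro ε hε
    obtain ⟨k₀, hk₀⟩ := Metric.tendsto_atTop.1 hg (ε / 2) (half_pos hε)
    refine ⟨k₀ + 1, fun s hs => ?_⟩
    rw [Real.dist_eq, sub_zero, abs_of_nonneg (D0 s)]
    refine lt_of_le_of_lt (ciSup_le fun k => ?_) (half_lt_self hε)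
    rcases le_total k₀ k with h | h
    · have := hk₀ k h
      rw [Real.dist_eq, sub_zero, abs_of_nonneg (hg0 k)] at this
      exact (mul_le_of_le_one_right (hg0 k) (φ1 k s)).trans this.le
    · have : (k : ℝ) ≤ k₀ := by exact_mod_cast h
      have : φ k s = 0 := max_eq_left ((min_le_right _ _).trans (by linarith))
      rw [this, mul_zero]; exact (half_pos hε).le
  -- `D` is only weakly decreasing; the summand `1 / (1 + s)` makes the function strictly
  -- decreasing.
  refine ⟨fun s => Real.toNNReal (D s + 1 / (1 + s)), ⟨?_, ?_, ?_⟩, fun k => ?_⟩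
  · refine continuous_real_toNNReal.comp ?_
    refine (Dcont.comp NNReal.continuous_coe).add ?_
    exact continuous_const.div (continuous_const.add NNReal.continuous_coe)
      fun s => by positivity
  · intro s t hst
    have hst' : (s : ℝ) < t := by exact_mod_cast hst
    have h1 := Danti s t hst'.le
    have h2 : (1 : ℝ) / (1 + t) < 1 / (1 + s) := by gcongr
    refine (Real.toNNReal_lt_toNNReal_iff ?_).2 (by linarith)
    have := D0 s
    positivity
  · have h : Tendsto (fun s : ℝ => D s + 1 / (1 + s)) atTop (𝓝 (0 + 0)) :=
      Dlim.add (tendsto_const_nhds.div_atTop (tendsto_atTop_add_const_left _ _ tendsto_id))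
    have := (continuous_real_toNNReal.tendsto _).comp
      (h.comp (NNReal.tendsto_coe_atTop.2 tendsto_id))
    simpa [Function.comp_def] using this
  · refine le_trans ?_ (Real.le_coe_toNNReal _)
    have h1 : g k * φ k k ≤ D k := le_ciSup (bdd k) k
    have h2 : φ k k = 1 := by simp [φ]
    rw [h2, mul_one] at h1
    have : (0 : ℝ) ≤ 1 / (1 + ((k : ℝ≥0) : ℝ)) := by positivity
    simp only [NNReal.coe_natCast] at this ⊢
    linarith

/-- Bounds that are uniform in `N` and eventually arbitrarily small give a bound of class `𝓛`. -/
theorem exists_classL_sInf_le (K : ℝ) {A : ℕ → Set ℝ} (h0 : ∀ N, ∀ a ∈ A N, 0 ≤ a)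
    (hK : ∀ N, 1 ≤ N → K ∈ A N) (h : ∀ η > 0, ∃ N₀ : ℕ, ∀ N, N₀ ≤ N → η ∈ A N) :
    ∃ δ : ℝ≥0 → ℝ≥0, ClassL δ ∧ ∀ N : ℕ, 1 ≤ N → sInf (A N) ≤ δ N := by
  have hA : ∀ N, BddBelow (A N) := fun N => ⟨0, h0 N⟩
  let g : ℕ → ℝ := fun N => if 1 ≤ N then sInf (A N) else 0
  have hg0 : ∀ N, 0 ≤ g N := fun N => by
    simp only [g]
    split_ifs
    · exact Real.sInf_nonneg (h0 N)
    · exact le_rfl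
  have hgK : ∀ N, g N ≤ K := fun N => by
    simp only [g]
    split_ifs with hN
    · exact csInf_le (hA N) (hK N hN)
    · exact h0 1 K (hK 1 le_rfl)
  have hg : Tendsto g atTop (𝓝 0) := by
    rw [Metric.tendsto_atTop]
    intro η hη
    obtain ⟨N₀, hN₀⟩ := h (η / 2) (half_pos hη)
    refine ⟨N₀ + 1, fun N hN => ?_⟩
    rw [Real.dist_eq, sub_zero, abs_of_nonneg (hg0 N)]
    simp only [g]
    rw [if_pos (by omega)]
    exact (csInf_le (hA N) (hN₀ N (by omega))).trans_lt (half_lt_self hη)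
  obtain ⟨δ, hδ, hgδ⟩ := exists_classL_ge g K hg0 hgK hg
  refine ⟨δ, hδ, fun N hN => ?_⟩
  have := hgδ N
  rwa [show g N = sInf (A N) from if_pos hN] at this

namespace Problem

variable {n m q : ℕ} {P : Problem n m q}

theorem J_add (P : Problem n m q) (k l : ℕ) (z : ℕ → EuclideanSpace ℝ (Fin n))
    (v : ℕ → EuclideanSpace ℝ (Fin m)) :
    P.J (k + l) z v = P.J k z v + P.J l (fun t => z (k + t)) (fun t => v (k + t)) :=
  Finset.sum_range_add _ _ _

/-! ### Dynamic programming -/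

/-- Following an admissible trajectory and then a feasible one is feasible. -/
theorem Admissible.concat {k l : ℕ} {z₀ : EuclideanSpace ℝ (Fin n)}
    {z z' : ℕ → EuclideanSpace ℝ (Fin n)} {v v' : ℕ → EuclideanSpace ℝ (Fin m)}
    (h : P.Admissible k z₀ z v) (h' : P.Feasible l (z k) z' v') :
    ∃ y u, P.Feasible (k + l) z₀ y u ∧ P.J (k + l) y u = P.J k z v + P.J l z' v' ∧
      y (k + l) = z' l := by
  obtain ⟨h0, h1⟩ := h
  obtain ⟨⟨h0', h1'⟩, hX⟩ := h'
  let y : ℕ → EuclideanSpace ℝ (Fin n) := fun t => if t < k then z t else z' (t - k)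
  let u : ℕ → EuclideanSpace ℝ (Fin m) := fun t => if t < k then v t else v' (t - k)
  have hy : ∀ t ≤ k, y t = z t := fun t ht => by
    rcases ht.lt_or_eq with h | rfl
    · simp [y, h]
    · simp [y, h0']
  have hu : ∀ t < k, u t = v t := fun t ht => by simp [u, ht]
  have hy' : ∀ t, y (k + t) = z' t := fun t => by simp [y]
  have hu' : ∀ t, u (k + t) = v' t := fun t => by simp [u]
  refine ⟨y, u, ⟨⟨by rw [hy 0 (Nat.zero_le _), h0], fun t ht => ?_⟩, by rw [hy']; exact hX⟩, ?_,
    hy' l⟩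
  · rcases lt_or_ge t k with h | h
    · rw [hy t h.le, hu t h, hy (t + 1) h]
      exact h1 t h
    · obtain ⟨s, rfl⟩ := Nat.exists_eq_add_of_le h
      rw [hy' s, hu' s, add_assoc, hy' (s + 1)]
      exact h1' s (by omega)
  · rw [J_add]
    congr 1
    · exact Finset.sum_congr rfl fun t ht => by
        have := Finset.mem_range.1 ht
        rw [hy t this.le, hu t this]
    · simp only [hy', hu']

theorem Feasible.shift {k l : ℕ} {z₀ : EuclideanSpace ℝ (Fin n)}
    {z : ℕ → EuclideanSpace ℝ (Fin n)} {v : ℕ → EuclideanSpace ℝ (Fin m)}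
    (h : P.Feasible (k + l) z₀ z v) :
    P.Feasible l (z k) (fun t => z (k + t)) (fun t => v (k + t)) :=
  ⟨⟨rfl, fun t ht => h.1.2 (k + t) (by omega)⟩, h.2⟩

theorem Feasible.take {k l : ℕ} {z₀ : EuclideanSpace ℝ (Fin n)}
    {z : ℕ → EuclideanSpace ℝ (Fin n)} {v : ℕ → EuclideanSpace ℝ (Fin m)}
    (h : P.Feasible (k + l) z₀ z v) : P.Admissible k z₀ z v :=
  ⟨h.1.1, fun t ht => h.1.2 t (by omega)⟩

theorem AdmissibleInf.take {z₀ : EuclideanSpace ℝ (Fin n)}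
    {z : ℕ → EuclideanSpace ℝ (Fin n)} {v : ℕ → EuclideanSpace ℝ (Fin m)}
    (h : P.AdmissibleInf z₀ z v) (k : ℕ) : P.Admissible k z₀ z v :=
  ⟨h.1, fun t _ => h.2 t⟩

/-- A feasible trajectory is prolonged by the terminal controller. -/
theorem Feasible.extend (h_term : P.TerminalAssumption) {k : ℕ} {z₀ : EuclideanSpace ℝ (Fin n)}
    {z : ℕ → EuclideanSpace ℝ (Fin n)} {v : ℕ → EuclideanSpace ℝ (Fin m)}
    (h : P.Feasible k z₀ z v) :
    ∃ y u, P.Feasible (k + 1) z₀ y u ∧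
      P.J (k + 1) y u + P.Vf (y (k + 1)) ≤ P.J k z v + P.Vf (z k) + P.ℓ (P.zs, P.vs) := by
  obtain ⟨-, -, -, κf, hκ⟩ := h_term
  obtain ⟨h1, h2, h3⟩ := hκ _ h.2
  have hf : P.Feasible 1 (z k)
      (fun t => if t = 0 then z k else P.fpi (z k) (κf (z k)) 0) (fun _ => κf (z k)) := by
    refine ⟨⟨by simp, fun t ht => ?_⟩, by simpa using h2⟩
    obtain rfl : t = 0 := by omega
    simpa using h1
  obtain ⟨y, u, hy, hJ, he⟩ := h.1.concat hf
  refine ⟨y, u, hy, ?_⟩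
  rw [hJ, he]
  simp only [J, Finset.sum_range_one, if_true, one_ne_zero, if_false]
  linarith

section Value

variable {zopt : ℕ → EuclideanSpace ℝ (Fin n) → ℕ → EuclideanSpace ℝ (Fin n)}
  {vopt : ℕ → EuclideanSpace ℝ (Fin n) → ℕ → EuclideanSpace ℝ (Fin m)}

theorem V_eq (h_opt : P.IsOptimalSelection zopt vopt) {N : ℕ} (hN : 1 ≤ N)
    {z₀ : EuclideanSpace ℝ (Fin n)} (hz : z₀ ∈ P.XN N) :
    P.V N z₀ = P.J N (zopt N z₀) (vopt N z₀) + P.Vf (zopt N z₀ N) := by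
  obtain ⟨h1, h2⟩ := h_opt N hN z₀ hz
  refine IsLeast.csInf_eq ⟨⟨_, _, h1, rfl⟩, ?_⟩
  rintro _ ⟨z, v, h, rfl⟩
  exact h2 z v h

theorem V_le (h_opt : P.IsOptimalSelection zopt vopt) {N : ℕ} (hN : 1 ≤ N)
    {z₀ : EuclideanSpace ℝ (Fin n)} {z : ℕ → EuclideanSpace ℝ (Fin n)}
    {v : ℕ → EuclideanSpace ℝ (Fin m)} (h : P.Feasible N z₀ z v) :
    P.V N z₀ ≤ P.J N z v + P.Vf (z N) := by
  have hz : z₀ ∈ P.XN N := ⟨z, v, h⟩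
  rw [V_eq h_opt hN hz]
  exact (h_opt N hN z₀ hz).2 z v h

theorem V_le_add (h_opt : P.IsOptimalSelection zopt vopt) {k l : ℕ} (hl : 1 ≤ l)
    {z₀ : EuclideanSpace ℝ (Fin n)} {z : ℕ → EuclideanSpace ℝ (Fin n)}
    {v : ℕ → EuclideanSpace ℝ (Fin m)} (h : P.Admissible k z₀ z v) (hz : z k ∈ P.XN l) :
    P.V (k + l) z₀ ≤ P.J k z v + P.V l (z k) := by
  obtain ⟨y, u, hy, hJ, he⟩ := h.concat (h_opt l hl _ hz).1
  have := V_le h_opt (by omega) hy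
  rw [hJ, he] at this
  rw [V_eq h_opt hl hz]
  linarith

/-- The tail of an optimal trajectory is feasible for the remaining horizon. With `V_le_add` this is
the dynamic programming principle. -/
theorem add_le_V (h_opt : P.IsOptimalSelection zopt vopt) {k l : ℕ} (hl : 1 ≤ l)
    {z₀ : EuclideanSpace ℝ (Fin n)} (hz : z₀ ∈ P.XN (k + l)) :
    P.J k (zopt (k + l) z₀) (vopt (k + l) z₀) + P.V l (zopt (k + l) z₀ k) ≤ P.V (k + l) z₀ := by
  have := V_le h_opt hl (h_opt (k + l) (by omega) z₀ hz).1.shift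
  rw [V_eq h_opt (by omega) hz, J_add]
  linarith

theorem XN_succ (h_term : P.TerminalAssumption) {N : ℕ} {z : EuclideanSpace ℝ (Fin n)}
    (hz : z ∈ P.XN N) : z ∈ P.XN (N + 1) := by
  obtain ⟨y, u, h⟩ := hz
  obtain ⟨y', u', h', -⟩ := h.extend h_term
  exact ⟨y', u', h'⟩

theorem Xf_subset_XN (h_term : P.TerminalAssumption) (N : ℕ) : P.Xf ⊆ P.XN N := by
  intro z hz
  induction N with
  | zero => exact ⟨fun _ => z, fun _ => 0, ⟨rfl, fun t ht => absurd ht (Nat.not_lt_zero t)⟩, hz⟩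
  | succ N ih => exact XN_succ h_term ih

/-- The terminal controller prolongs an optimal trajectory at a price of at most `ℓ_s` per step. For
`ℓ_s = 0` the value is therefore nonincreasing in the horizon. -/
theorem V_add_le (h_opt : P.IsOptimalSelection zopt vopt) (h_term : P.TerminalAssumption)
    {N : ℕ} (hN : 1 ≤ N) {z : EuclideanSpace ℝ (Fin n)} (hz : z ∈ P.XN N) (k : ℕ) :
    P.V (N + k) z ≤ P.V N z + k * P.ℓ (P.zs, P.vs) ∧ z ∈ P.XN (N + k) := by
  induction k with
  | zero => simpa using hz
  | succ k ih =>
    refine ⟨?_, XN_succ h_term ih.2⟩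
    have hk : 1 ≤ N + k := by omega
    obtain ⟨y, u, h, hJ⟩ := (h_opt _ hk z ih.2).1.extend h_term
    have h1 := V_le h_opt (by omega) h
    rw [← V_eq h_opt hk ih.2] at hJ
    have h2 := ih.1
    rw [← add_assoc]
    push_cast
    linarith

/-- Shifting the optimal trajectory and prolonging it by the terminal controller gives a feasible
trajectory from `f_π(z, v, 0)`. This state competes in the choice of `ini`, since the successor
differs from it by an element of `Ω`; re-initialization can only lower the value further. -/
theorem V_closedLoop_le (h_opt : P.IsOptimalSelection zopt vopt)
    {ini : ℕ → EuclideanSpace ℝ (Fin n) → EuclideanSpace ℝ (Fin n)}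
    (h_ini : P.IsOptimalInitial ini) (h_term : P.TerminalAssumption) {N : ℕ} (hN : 1 ≤ N)
    {z z' : EuclideanSpace ℝ (Fin n)} (hz : z ∈ P.XN N) (hz' : z' ∈ P.Zcl vopt ini N z) :
    z' ∈ P.XN N ∧ P.V N z' ≤ P.V N z - P.ℓ (z, vopt N z 0) + P.ℓ (P.zs, P.vs) := by
  obtain ⟨l, rfl⟩ := Nat.exists_eq_add_of_le hN
  obtain ⟨e, he, rfl⟩ := hz'
  obtain ⟨hf, -⟩ := h_opt _ hN z hz
  obtain ⟨y, u, hy, hJ⟩ := hf.shift.extend h_term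
  rw [add_comm l 1] at hy hJ
  have h1 : zopt (1 + l) z 1 = P.fpi z (vopt (1 + l) z 0) 0 := by
    have := (hf.1.2 0 (by omega)).1
    rwa [hf.1.1] at this
  rw [h1] at hy
  obtain ⟨⟨hX, -⟩, hmin⟩ := h_ini (1 + l) hN (P.fpi z (vopt (1 + l) z 0) 0 + e)
    ⟨_, ⟨y, u, hy⟩, by simpa using he⟩
  refine ⟨hX, ?_⟩
  have h2 := hmin _ ⟨y, u, hy⟩ (by simpa using he)
  have h3 := V_le h_opt hN hy
  have h4 := V_eq h_opt hN hz
  rw [J_add] at h4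
  have h5 : P.J 1 (zopt (1 + l) z) (vopt (1 + l) z) = P.ℓ (z, vopt (1 + l) z 0) := by
    simp [J, hf.1.1]
  linarith

theorem J_closedLoop_le (h_opt : P.IsOptimalSelection zopt vopt)
    {ini : ℕ → EuclideanSpace ℝ (Fin n) → EuclideanSpace ℝ (Fin n)}
    (h_ini : P.IsOptimalInitial ini) (h_term : P.TerminalAssumption) {N : ℕ} (hN : 1 ≤ N)
    {z : ℕ → EuclideanSpace ℝ (Fin n)} (hz : P.IsClosedLoop vopt ini N z) (T : ℕ) :
    z T ∈ P.XN N ∧ P.J T z (fun t => vopt N (z t) 0) ≤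
      P.V N (z 0) - P.V N (z T) + T * P.ℓ (P.zs, P.vs) := by
  induction T with
  | zero => simpa [J] using hz.1
  | succ T ih =>
    obtain ⟨h1, h2⟩ := V_closedLoop_le h_opt h_ini h_term hN ih.1 (hz.2 T)
    refine ⟨h1, ?_⟩
    have h3 := ih.2
    simp only [J, Finset.sum_range_succ] at h3 ⊢
    push_cast
    linarith

end Value

/-! ### Dissipativity -/

/-- The dissipation inequality summed along a sequence. -/
theorem sum_dissipation (lam : EuclideanSpace ℝ (Fin n) → ℝ) (α : ℝ≥0 → ℝ≥0)
    {z : ℕ → EuclideanSpace ℝ (Fin n)} {v : ℕ → EuclideanSpace ℝ (Fin m)} (T : ℕ)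
    (h : ∀ t < T, lam (z (t + 1)) - lam (z t) ≤
      P.ℓ (z t, v t) - P.ℓ (P.zs, P.vs) - (α ‖(z t, v t) - (P.zs, P.vs)‖₊ : ℝ)) :
    lam (z T) - lam (z 0) + T * P.ℓ (P.zs, P.vs) +
      ∑ t ∈ Finset.range T, (α ‖(z t, v t) - (P.zs, P.vs)‖₊ : ℝ) ≤ P.J T z v := by
  induction T with
  | zero => simp [J]
  | succ T ih =>
    have h1 := ih fun t ht => h t (by omega)
    have h2 := h T (by omega)
    simp only [J, Finset.sum_range_succ] at h1 ⊢
    push_cast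
    linarith

theorem Admissible.sum_dissipation {lam : EuclideanSpace ℝ (Fin n) → ℝ} {α : ℝ≥0 → ℝ≥0}
    (h : P.StrictlyDissipative lam α) {T : ℕ} {z₀ : EuclideanSpace ℝ (Fin n)}
    {z : ℕ → EuclideanSpace ℝ (Fin n)} {v : ℕ → EuclideanSpace ℝ (Fin m)}
    (hz : P.Admissible T z₀ z v) :
    lam (z T) - lam (z 0) + T * P.ℓ (P.zs, P.vs) +
      ∑ t ∈ Finset.range T, (α ‖(z t, v t) - (P.zs, P.vs)‖₊ : ℝ) ≤ P.J T z v :=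
  Problem.sum_dissipation lam α T fun t ht => by
    rw [(hz.2 t ht).1]
    exact h.2.2 _ _ (hz.2 t ht).2

theorem Admissible.le_J {lam : EuclideanSpace ℝ (Fin n) → ℝ} {α : ℝ≥0 → ℝ≥0}
    (h : P.StrictlyDissipative lam α) {T : ℕ} {z₀ : EuclideanSpace ℝ (Fin n)}
    {z : ℕ → EuclideanSpace ℝ (Fin n)} {v : ℕ → EuclideanSpace ℝ (Fin m)}
    (hz : P.Admissible T z₀ z v) :
    lam (z T) - lam (z 0) + T * P.ℓ (P.zs, P.vs) ≤ P.J T z v := by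
  have h1 := hz.sum_dissipation h
  have h2 : (0 : ℝ) ≤ ∑ t ∈ Finset.range T, (α ‖(z t, v t) - (P.zs, P.vs)‖₊ : ℝ) :=
    Finset.sum_nonneg fun _ _ => NNReal.coe_nonneg _
  linarith

theorem ClassKInf.tendsto_zero_of_comp {α : ℝ≥0 → ℝ≥0} (hα : ClassKInf α) {r : ℕ → ℝ≥0}
    (h : Tendsto (fun t => α (r t)) atTop (𝓝 0)) : Tendsto r atTop (𝓝 0) := by
  rw [tendsto_order]
  refine ⟨fun a ha => absurd ha not_lt_zero, fun a ha => ?_⟩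
  have : 0 < α a := by
    have := hα.2.1 ha
    rwa [hα.2.2.1] at this
  filter_upwards [h.eventually (gt_mem_nhds this)] with t ht
  exact hα.2.1.lt_iff_lt.1 ht

/-- States converge to the steady state if the dissipation rate has bounded sums. -/
theorem tendsto_of_sum_dissipation_le {α : ℝ≥0 → ℝ≥0} (hα : ClassKInf α)
    {z : ℕ → EuclideanSpace ℝ (Fin n)} {v : ℕ → EuclideanSpace ℝ (Fin m)} (S : ℝ)
    (h : ∀ T, ∑ t ∈ Finset.range T, (α ‖(z t, v t) - (P.zs, P.vs)‖₊ : ℝ) ≤ S) :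
    Tendsto z atTop (𝓝 P.zs) := by
  have hs := (summable_of_sum_range_le (fun t => NNReal.coe_nonneg _) h).tendsto_atTop_zero
  have h1 := ClassKInf.tendsto_zero_of_comp hα (r := fun t => ‖(z t, v t) - (P.zs, P.vs)‖₊)
    (NNReal.tendsto_coe.1 hs)
  rw [tendsto_iff_norm_sub_tendsto_zero]
  refine squeeze_zero (fun _ => norm_nonneg _) (fun t => ?_) (NNReal.tendsto_coe.2 h1)
  exact norm_fst_le ((z t, v t) - (P.zs, P.vs))

/-- A state close to the steady state exists in every long enough time window. -/
theorem exists_norm_le_of_sum_dissipation_lt {α : ℝ≥0 → ℝ≥0} (hα : ClassKInf α)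
    {z : ℕ → EuclideanSpace ℝ (Fin n)} {v : ℕ → EuclideanSpace ℝ (Fin m)} {T : Finset ℕ}
    {δ : ℝ≥0} (h : ∑ t ∈ T, (α ‖(z t, v t) - (P.zs, P.vs)‖₊ : ℝ) < T.card * α δ) :
    ∃ t ∈ T, ‖z t - P.zs‖ ≤ δ := by
  by_contra! hc
  refine h.not_ge ?_
  rw [← nsmul_eq_mul]
  refine Finset.card_nsmul_le_sum _ _ _ fun t ht => NNReal.coe_le_coe.2 (hα.2.1.monotone ?_)
  exact NNReal.coe_le_coe.1 ((hc t ht).le.trans (norm_fst_le ((z t, v t) - (P.zs, P.vs))))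

/-! ### Bounds -/

theorem exists_norm_sub_le (h_sets : P.ConstraintSets) (h_rci : P.RCIAssumption) :
    ∃ R : ℝ≥0, ∀ z v, (z, v) ∈ P.Zbar → ‖z - P.zs‖ ≤ R := by
  -- One element of `Ω` suffices: `z + e` is the state component of a point of the compact set `ZZ`.
  obtain ⟨e, he⟩ := h_rci.2.1
  obtain ⟨C, hC⟩ := h_sets.1.1.isBounded.exists_norm_le
  refine ⟨Real.toNNReal (C + ‖e‖ + ‖P.zs‖), fun z v hz => le_trans ?_ (Real.le_coe_toNNReal _)⟩
  have h1 : ‖z + e‖ ≤ C := (norm_fst_le _).trans (hC _ (hz e (interior_subset he)))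
  have h2 : z - P.zs = (z + e) - e - P.zs := by abel
  rw [h2]
  have h3 := norm_sub_le (z + e - e) P.zs
  have h4 := norm_sub_le (z + e) e
  linarith

theorem exists_Zbar_of_mem_XN {N : ℕ} (hN : 1 ≤ N) {z : EuclideanSpace ℝ (Fin n)}
    (hz : z ∈ P.XN N) : ∃ v, (z, v) ∈ P.Zbar := by
  obtain ⟨y, u, h⟩ := hz
  exact ⟨u 0, h.1.1 ▸ (h.1.2 0 hN).2⟩

theorem exists_abs_Vf_le (h_sets : P.ConstraintSets) (h_rci : P.RCIAssumption)
    (h_term : P.TerminalAssumption) : ∃ C, ∀ z ∈ P.Xf, |P.Vf z| ≤ C := by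
  obtain ⟨R, hR⟩ := exists_norm_sub_le h_sets h_rci
  obtain ⟨hcl, -, hcont, κf, hκ⟩ := h_term
  have hb : Bornology.IsBounded P.Xf :=
    Metric.isBounded_closedBall (x := P.zs) (r := R) |>.subset fun z hz => by
      rw [mem_closedBall_iff_norm]
      exact hR _ _ (hκ z hz).1
  obtain ⟨C, hC⟩ := (Metric.isCompact_of_isClosed_isBounded hcl hb).exists_bound_of_continuousOn
    hcont
  exact ⟨C, hC⟩

theorem abs_stageCost_sub_le (h_rci : P.RCIAssumption) (h_cost : P.StageCostAssumption)
    (h_ross : P.ROSSAssumption) :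
    ∃ κ : ℝ≥0, ∀ p ∈ P.Zbar, |P.ℓ p - P.ℓ (P.zs, P.vs)| ≤ κ * ‖p - (P.zs, P.vs)‖ := by
  obtain ⟨-, -, κ, -, hκ⟩ := h_cost
  refine ⟨κ, fun p hp => ?_⟩
  have := hκ.dist_le_mul p (h_rci.2.2.2 hp) _ (h_rci.2.2.2 (interior_subset h_ross.2.2))
  rwa [Real.dist_eq, dist_eq_norm] at this

/-- The storage function is continuous at the steady state. -/
theorem exists_abs_storage_sub_le (h_rci : P.RCIAssumption) (h_cost : P.StageCostAssumption)
    (h_ross : P.ROSSAssumption) (h_ctrl : P.LocallyControllable)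
    {lam : EuclideanSpace ℝ (Fin n) → ℝ} {α : ℝ≥0 → ℝ≥0} (h : P.StrictlyDissipative lam α)
    {η : ℝ} (hη : 0 < η) :
    ∃ δ > 0, ∀ y, ‖y - P.zs‖ ≤ δ → |lam y - lam P.zs| ≤ η := by
  obtain ⟨κ, hκ⟩ := abs_stageCost_sub_le h_rci h_cost h_ross
  obtain ⟨M, hM, hc⟩ := h_ctrl
  obtain ⟨r, hr, hball⟩ := Metric.isOpen_iff.1 isOpen_interior _ h_ross.2.2
  have hM0 : (0 : ℝ) < M := by exact_mod_cast hM
  -- `r / 2` keeps the connecting path in `Zbar`; the other term makes its excess cost `M * κ * ε`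
  -- at most `η`.
  let ε := min (r / 2) (η / (M * (κ + 1)))
  have hε : 0 < ε := by positivity
  obtain ⟨δ, hδ, hd⟩ := hc ε hε
  -- Dissipation along a cheap path from `y` to `y'` bounds the increase of `lam`. Paths exist in
  -- both directions, so continuity follows with one endpoint at `z_s`.
  have key : ∀ y y', ‖y - P.zs‖ ≤ δ → ‖y' - P.zs‖ ≤ δ → lam y' - lam y ≤ η := by
    intro y y' hy hy'
    obtain ⟨z, v, rfl, rfl, hz⟩ := hd y y' hy hy'
    have hZ : ∀ t < M, (z t, v t) ∈ P.Zbar := fun t ht => interior_subset <| hball <| by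
      rw [mem_ball_iff_norm]
      exact ((hz t ht).2.trans (min_le_left _ _)).trans_lt (half_lt_self hr)
    have h1 := Admissible.le_J h (T := M) (z₀ := z 0) (z := z) (v := v)
      ⟨rfl, fun t ht => ⟨(hz t ht).1, hZ t ht⟩⟩
    have h2 : P.J M z v ≤ M * (P.ℓ (P.zs, P.vs) + κ * ε) := by
      have := Finset.sum_le_card_nsmul (Finset.range M) (fun t => P.ℓ (z t, v t))
        (P.ℓ (P.zs, P.vs) + κ * ε) fun t ht => by
          have ht := Finset.mem_range.1 ht
          have h3 := (le_abs_self _).trans (hκ _ (hZ t ht))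
          have h4 := mul_le_mul_of_nonneg_left (hz t ht).2 κ.coe_nonneg
          linarith
      simpa only [J, Finset.card_range, nsmul_eq_mul] using this
    have h5 : M * (κ * ε) ≤ η := by
      have h6 : ε * (M * (κ + 1)) ≤ η := (le_div_iff₀ (by positivity)).1 (min_le_right _ _)
      nlinarith [mul_pos hM0 hε]
    linarith
  have h0 : ‖P.zs - P.zs‖ ≤ δ := by simpa using hδ.le
  exact ⟨δ, hδ, fun y hy => abs_le.2
    ⟨by linarith [key y _ hy h0], by linarith [key _ y h0 hy]⟩⟩

section Performance

variable {zopt : ℕ → EuclideanSpace ℝ (Fin n) → ℕ → EuclideanSpace ℝ (Fin n)}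
  {vopt : ℕ → EuclideanSpace ℝ (Fin n) → ℕ → EuclideanSpace ℝ (Fin m)}

/-! ### Infinite horizon performance -/

/-- If the infinite horizon cost is below `C`, the dissipation rate has bounded sums. -/
theorem AdmissibleInf.sum_dissipation_le (hs : P.ℓ (P.zs, P.vs) = 0)
    {lam : EuclideanSpace ℝ (Fin n) → ℝ} {α : ℝ≥0 → ℝ≥0}
    (h : P.StrictlyDissipative lam α) {B : ℝ} (hB : ∀ z, |lam z| ≤ B)
    {z₀ : EuclideanSpace ℝ (Fin n)} {z : ℕ → EuclideanSpace ℝ (Fin n)}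
    {v : ℕ → EuclideanSpace ℝ (Fin m)} (hz : P.AdmissibleInf z₀ z v) {C : ℝ}
    (hC : P.Jinf z v < C) (T : ℕ) :
    ∑ t ∈ Finset.range T, (α ‖(z t, v t) - (P.zs, P.vs)‖₊ : ℝ) ≤ C + 2 * B := by
  -- `J_T` itself may exceed `C`, but some later `J_T'` does not, and the dissipation sum only grows
  -- with the horizon.
  obtain ⟨T', hT, hJ⟩ := ((eventually_ge_atTop T).and (eventually_lt_of_limsup_lt hC)).exists
  have h1 := (hz.take T').sum_dissipation h
  have h2 : P.J T' z v < C := by exact_mod_cast hJ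
  have h3 := abs_le.1 (hB (z T'))
  have h4 := abs_le.1 (hB (z 0))
  have h5 := Finset.sum_le_sum_of_subset_of_nonneg (Finset.range_mono hT)
    fun t _ _ => NNReal.coe_nonneg (α ‖(z t, v t) - (P.zs, P.vs)‖₊)
  rw [hs] at h1
  linarith

/-- Near the steady state the remaining cost is almost nonnegative. -/
theorem AdmissibleInf.J_sub_le_Jinf (hs : P.ℓ (P.zs, P.vs) = 0)
    {lam : EuclideanSpace ℝ (Fin n) → ℝ} {α : ℝ≥0 → ℝ≥0}
    (h : P.StrictlyDissipative lam α) {z₀ : EuclideanSpace ℝ (Fin n)}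
    {z : ℕ → EuclideanSpace ℝ (Fin n)} {v : ℕ → EuclideanSpace ℝ (Fin m)}
    (hz : P.AdmissibleInf z₀ z v) (k : ℕ) {c : ℝ}
    (hc : ∀ᶠ T in atTop, lam (z k) - lam (z T) ≤ c) :
    ((P.J k z v - c : ℝ) : EReal) ≤ P.Jinf z v := by
  refine le_limsup_of_frequently_le (Eventually.frequently ?_)
  filter_upwards [hc, eventually_ge_atTop k] with T hT hk
  obtain ⟨l, rfl⟩ := Nat.exists_eq_add_of_le hk
  have h1 := Admissible.le_J h (T := l) (z₀ := z k) (z := fun t => z (k + t))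
    (v := fun t => v (k + t)) ⟨rfl, fun t _ => hz.2 (k + t)⟩
  rw [hs] at h1
  simp only [add_zero, mul_zero] at h1
  have h2 := P.J_add k l z v
  exact_mod_cast (by linarith : P.J k z v - c ≤ P.J (k + l) z v)

/-- On long horizons the optimal value, relative to its value at the steady state, is almost below
the cost of every infinite trajectory of bounded cost. -/
theorem exists_V_sub_le_Jinf (h_opt : P.IsOptimalSelection zopt vopt)
    (h_sets : P.ConstraintSets) (h_rci : P.RCIAssumption) (h_cost : P.StageCostAssumption)
    (h_term : P.TerminalAssumption) (h_ross : P.ROSSAssumption) (h_ctrl : P.LocallyControllable)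
    {lam : EuclideanSpace ℝ (Fin n) → ℝ} {α : ℝ≥0 → ℝ≥0} (h : P.StrictlyDissipative lam α)
    (h_cont : P.ValueContinuity) (hs : P.ℓ (P.zs, P.vs) = 0) (C : ℝ) {η : ℝ} (hη : 0 < η) :
    ∃ N₀ : ℕ, ∀ N, N₀ ≤ N → ∀ z₀ ∈ P.XN N, ∀ z v, P.AdmissibleInf z₀ z v → P.Jinf z v < C →
      ((P.V N z₀ - P.V N P.zs - 5 * η : ℝ) : EReal) ≤ P.Jinf z v := by
  obtain ⟨B, hB⟩ := h.2.1
  obtain ⟨CV, hCV⟩ := exists_abs_Vf_le h_sets h_rci h_term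
  obtain ⟨αV, hαV, hV⟩ := h_cont
  obtain ⟨δ₁, hδ₁, hl⟩ := exists_abs_storage_sub_le h_rci h_cost h_ross h_ctrl h hη
  obtain ⟨δ₂, hδ₂, hX⟩ := Metric.mem_nhds_iff.1 (mem_interior_iff_mem_nhds.1 h_term.2.1)
  have hαV0 : ∀ᶠ s in 𝓝 (0 : ℝ≥0), (αV s : ℝ) < η :=
    ((NNReal.continuous_coe.comp hαV.1).tendsto 0).eventually
      (gt_mem_nhds (by simpa [hαV.2.2.1] using hη))
  obtain ⟨δ₃, hδ₃, hα3⟩ := Metric.eventually_nhds_iff.1 hαV0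
  -- Within distance `d` of `z_s`, the storage function and every `V_N` vary by at most `η`, and the
  -- terminal region is not left.
  let d : ℝ := min δ₁ (min (δ₂ / 2) (δ₃ / 2))
  have hd : 0 < d := by positivity
  have near_lam : ∀ y, ‖y - P.zs‖ ≤ d → |lam y - lam P.zs| ≤ η := fun y hy =>
    hl y (hy.trans (min_le_left _ _))
  have near_Xf : ∀ y, ‖y - P.zs‖ ≤ d → y ∈ P.Xf := fun y hy => hX <| by
    rw [mem_ball_iff_norm]
    exact (hy.trans ((min_le_right _ _).trans (min_le_left _ _))).trans_lt (half_lt_self hδ₂)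
  have near_V : ∀ N, 1 ≤ N → ∀ y, ‖y - P.zs‖ ≤ d → |P.V N y - P.V N P.zs| ≤ η := by
    intro N hN y hy
    refine (hV N hN y (Xf_subset_XN h_term N (near_Xf y hy))).trans (hα3 ?_).le
    rw [NNReal.dist_eq, NNReal.coe_zero, sub_zero, coe_nnnorm, abs_norm]
    exact (hy.trans ((min_le_right _ _).trans (min_le_right _ _))).trans_lt
      (half_lt_self hδ₃)
  let D : ℝ≥0 := ⟨d, hd.le⟩
  have hD : (0 : ℝ) < α D := by
    have : α 0 < α D := h.1.2.1 (by exact_mod_cast hd)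
    rw [h.1.2.2.1] at this
    exact_mod_cast this
  have hzsX : P.zs ∈ P.Xf := interior_subset h_term.2.1
  -- `K * α d` exceeds the dissipation budgets of both trajectories: `C + 2B` for the infinite one,
  -- `2CV + 2B` for the optimal one from `z_s`. Neither can stay farther than `d` from `z_s` for `K`
  -- steps.
  obtain ⟨K, hK⟩ := exists_nat_gt (max (C + 2 * B) (2 * CV + 2 * B) / α D)
  rw [div_lt_iff₀ hD] at hK
  refine ⟨2 * (K + 1), fun N hN z₀ hz₀ z v hz hC => ?_⟩
  -- an early time at which the infinite trajectory is near the steady state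
  obtain ⟨k, hk, hzk⟩ := exists_norm_le_of_sum_dissipation_lt (P := P) h.1 (z := z) (v := v)
    (T := Finset.range K) (δ := D)
    (lt_of_le_of_lt (hz.sum_dissipation_le hs h hB hC K)
      (by simpa using (le_max_left _ _).trans_lt hK))
  have hk := Finset.mem_range.1 hk
  -- a late time at which the optimal trajectory from the steady state is near it
  have hzsN : P.zs ∈ P.XN N := Xf_subset_XN h_term N hzsX
  have hfs := (h_opt N (by omega) _ hzsN).1
  obtain ⟨l, hlK, hzl⟩ : ∃ l ∈ Finset.Ico K (2 * K), ‖zopt N P.zs l - P.zs‖ ≤ D := by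
    refine exists_norm_le_of_sum_dissipation_lt (P := P) h.1 (v := vopt N P.zs) ?_
    have h1 := hfs.1.sum_dissipation h
    have h2 : P.V N P.zs ≤ P.Vf P.zs := by
      have hst : P.Feasible N P.zs (fun _ => P.zs) (fun _ => P.vs) :=
        ⟨⟨rfl, fun _ _ => ⟨h_ross.1, interior_subset h_ross.2.2⟩⟩, hzsX⟩
      simpa [J, hs] using V_le h_opt (by omega) hst
    rw [V_eq h_opt (by omega) hzsN] at h2
    have h3 := abs_le.1 (hCV _ hfs.2)
    have h4 := abs_le.1 (hCV _ hzsX)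
    have h5 := abs_le.1 (hB (zopt N P.zs N))
    have h6 := abs_le.1 (hB (zopt N P.zs 0))
    have h7 : Finset.Ico K (2 * K) ⊆ Finset.range N := fun t ht => by
      have := Finset.mem_Ico.1 ht
      exact Finset.mem_range.2 (by omega)
    have h8 := Finset.sum_le_sum_of_subset_of_nonneg h7 fun t _ _ =>
      NNReal.coe_nonneg (α ‖(zopt N P.zs t, vopt N P.zs t) - (P.zs, P.vs)‖₊)
    have h9 : (Finset.Ico K (2 * K)).card = K := by simp; omega
    rw [h9]
    rw [hs] at h1
    refine lt_of_le_of_lt ?_ ((le_max_right _ _).trans_lt hK)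
    linarith
  have hlK := Finset.mem_Ico.1 hlK
  have e1 : P.V N z₀ ≤ P.J k z v + P.V (N - k) (z k) := by
    have := V_le_add h_opt (l := N - k) (by omega) (hz.take k)
      (Xf_subset_XN h_term _ (near_Xf _ hzk))
    rwa [Nat.add_sub_of_le (by omega)] at this
  have e2 := abs_le.1 (near_V (N - k) (by omega) _ hzk)
  -- The window starting at `K` ensures `k < l`, so `N - k` is the longer horizon and has the
  -- smaller value.
  have e3 : P.V (N - k) P.zs ≤ P.V (N - l) P.zs := by
    have := (V_add_le h_opt h_term (N := N - l) (by omega) (Xf_subset_XN h_term _ hzsX) (l - k)).1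
    rwa [hs, mul_zero, add_zero, show N - l + (l - k) = N - k by omega] at this
  have e4 := abs_le.1 (near_V (N - l) (by omega) _ hzl)
  have e5 : P.J l (zopt N P.zs) (vopt N P.zs) + P.V (N - l) (zopt N P.zs l) ≤ P.V N P.zs := by
    have hN' : l + (N - l) = N := by omega
    have := add_le_V h_opt (k := l) (l := N - l) (by omega) (z₀ := P.zs) (by rwa [hN'])
    rwa [hN'] at this
  have e6 : -η ≤ P.J l (zopt N P.zs) (vopt N P.zs) := by
    have h1 := Admissible.le_J h (T := l) (z₀ := P.zs) (z := zopt N P.zs) (v := vopt N P.zs)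
      ⟨hfs.1.1, fun t ht => hfs.1.2 t (by omega)⟩
    have h2 := abs_le.1 (near_lam _ hzl)
    rw [hs, hfs.1.1] at h1
    linarith
  have e7 : ((P.J k z v - 2 * η : ℝ) : EReal) ≤ P.Jinf z v := by
    refine hz.J_sub_le_Jinf hs h k ?_
    have hlim := tendsto_of_sum_dissipation_le h.1 _ (hz.sum_dissipation_le hs h hB hC)
    filter_upwards [hlim.eventually (Metric.closedBall_mem_nhds P.zs hd)] with T hT
    have h1 := abs_le.1 (near_lam _ (mem_closedBall_iff_norm.1 hT))
    have h2 := abs_le.1 (near_lam _ hzk)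
    linarith
  -- Of the `5 * η`, one each comes from `e2`, `e4` and `e6`, and two from `e7`.
  refine le_trans ?_ e7
  exact_mod_cast (by linarith : P.V N z₀ - P.V N P.zs - 5 * η ≤ P.J k z v - 2 * η)

theorem AdmissibleInf.neg_two_mul_le_Jinf (hs : P.ℓ (P.zs, P.vs) = 0)
    {lam : EuclideanSpace ℝ (Fin n) → ℝ} {α : ℝ≥0 → ℝ≥0}
    (h : P.StrictlyDissipative lam α) {B : ℝ} (hB : ∀ z, |lam z| ≤ B)
    {z₀ : EuclideanSpace ℝ (Fin n)} {z : ℕ → EuclideanSpace ℝ (Fin n)}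
    {v : ℕ → EuclideanSpace ℝ (Fin m)} (hz : P.AdmissibleInf z₀ z v) :
    ((-(2 * B) : ℝ) : EReal) ≤ P.Jinf z v := by
  have := hz.J_sub_le_Jinf hs h 0 (c := 2 * B) (Eventually.of_forall fun T => by
    linarith [abs_le.1 (hB (z 0)), abs_le.1 (hB (z T))])
  simpa [J] using this

/-- A crude bound uniform in horizon and state, from boundedness of `Zbar`. It serves short
horizons, expensive trajectories and the closed-loop drift. -/
theorem exists_V_sub_le (h_sets : P.ConstraintSets) (h_rci : P.RCIAssumption)
    (h_cont : P.ValueContinuity) :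
    ∃ C : ℝ, 0 ≤ C ∧ ∀ N, 1 ≤ N → ∀ z ∈ P.XN N, |P.V N z - P.V N P.zs| ≤ C := by
  obtain ⟨R, hR⟩ := exists_norm_sub_le h_sets h_rci
  obtain ⟨α, hα, hV⟩ := h_cont
  refine ⟨α R, NNReal.coe_nonneg _, fun N hN z hz => ?_⟩
  obtain ⟨v, hv⟩ := exists_Zbar_of_mem_XN hN hz
  have h1 : ‖z - P.zs‖₊ ≤ R := hR z v hv
  exact (hV N hN z hz).trans (NNReal.coe_le_coe.2 (hα.2.1.monotone h1))

/-- The optimal value relative to the steady state exceeds `V_∞` by at most an `𝓛`-function of the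
horizon. -/
theorem exists_classL_V_sub_le_Vinf (h_opt : P.IsOptimalSelection zopt vopt)
    (h_sets : P.ConstraintSets) (h_rci : P.RCIAssumption) (h_cost : P.StageCostAssumption)
    (h_term : P.TerminalAssumption) (h_ross : P.ROSSAssumption) (h_ctrl : P.LocallyControllable)
    {lam : EuclideanSpace ℝ (Fin n) → ℝ} {α : ℝ≥0 → ℝ≥0} (h : P.StrictlyDissipative lam α)
    (h_cont : P.ValueContinuity) (hs : P.ℓ (P.zs, P.vs) = 0) :
    ∃ δ : ℝ≥0 → ℝ≥0, ClassL δ ∧ ∀ N : ℕ, 1 ≤ N → ∀ z₀ ∈ P.XN N,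
      ((P.V N z₀ - P.V N P.zs : ℝ) : EReal) ≤ P.Vinf z₀ + ((δ N : ℝ) : EReal) := by
  obtain ⟨B, hB⟩ := h.2.1
  have hB0 : 0 ≤ B := (abs_nonneg _).trans (hB 0)
  obtain ⟨C, hC0, hVC⟩ := exists_V_sub_le h_sets h_rci h_cont
  have hAC : ∀ N, 1 ≤ N → 0 ≤ C + 2 * B ∧ ∀ z₀ ∈ P.XN N, ∀ z v, P.AdmissibleInf z₀ z v →
      ((P.V N z₀ - P.V N P.zs - (C + 2 * B) : ℝ) : EReal) ≤ P.Jinf z v := fun N hN =>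
    ⟨by positivity, fun z₀ hz₀ z v hz => by
      refine le_trans ?_ (hz.neg_two_mul_le_Jinf hs h hB)
      have := (abs_le.1 (hVC N hN z₀ hz₀)).2
      exact EReal.coe_le_coe (by linarith)⟩
  have hAη : ∀ η > 0, ∃ N₀ : ℕ, ∀ N, N₀ ≤ N → 0 ≤ η ∧
      ∀ z₀ ∈ P.XN N, ∀ z v, P.AdmissibleInf z₀ z v →
        ((P.V N z₀ - P.V N P.zs - η : ℝ) : EReal) ≤ P.Jinf z v := by
    intro η hη
    obtain ⟨N₀, hN₀⟩ := exists_V_sub_le_Jinf h_opt h_sets h_rci h_cost h_term h_ross h_ctrl h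
      h_cont hs C (η := η / 5) (by positivity)
    refine ⟨N₀ + 1, fun N hN => ⟨hη.le, fun z₀ hz₀ z v hz => ?_⟩⟩
    -- If the cost is at least `C`, the crude bound `V_N(z₀) - V_N(z_s) ≤ C` already suffices.
    rcases lt_or_ge (P.Jinf z v) C with hC | hC
    · have := hN₀ N (by omega) z₀ hz₀ z v hz hC
      rwa [mul_div_cancel₀ η (by norm_num)] at this
    · refine le_trans ?_ hC
      have := (abs_le.1 (hVC N (by omega) z₀ hz₀)).2
      exact EReal.coe_le_coe (by linarith)
  obtain ⟨δ, hδ, hA⟩ := exists_classL_sInf_le (C + 2 * B)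
    (A := fun N => {a | 0 ≤ a ∧ ∀ z₀ ∈ P.XN N, ∀ z v, P.AdmissibleInf z₀ z v →
      ((P.V N z₀ - P.V N P.zs - a : ℝ) : EReal) ≤ P.Jinf z v})
    (fun N a ha => ha.1) hAC hAη
  refine ⟨δ, hδ, fun N hN z₀ hz₀ => ?_⟩
  rw [← EReal.sub_le_iff_le_add (.inl (EReal.coe_ne_bot _)) (.inl (EReal.coe_ne_top _))]
  refine le_sInf ?_
  rintro _ ⟨z, v, hz, rfl⟩
  -- Testing against reals `x` above `Jinf` covers infinite values and turns the claim into a lower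
  -- bound for every admissible error `a`, hence for their infimum.
  refine EReal.le_of_forall_lt_iff_le.1 fun x hx => ?_
  have h1 : P.V N z₀ - P.V N P.zs - x ≤ δ N := by
    refine le_trans (le_csInf ⟨C + 2 * B, hAC N hN⟩ fun a ha => ?_) (hA N hN)
    have : P.V N z₀ - P.V N P.zs - a < x := by
      exact_mod_cast (ha.2 z₀ hz₀ z v hz).trans_lt hx
    linarith
  exact_mod_cast (by linarith : P.V N z₀ - P.V N P.zs - δ N ≤ x)

/-! ### Finiteness of `V_∞`. -/

theorem Vinf_lt_top (h_rci : P.RCIAssumption) (h_cost : P.StageCostAssumption)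
    (h_ross : P.ROSSAssumption) (h_reach : P.ExponentiallyReachable)
    (hs : P.ℓ (P.zs, P.vs) = 0) {N : ℕ} (hN : 1 ≤ N) {z₀ : EuclideanSpace ℝ (Fin n)}
    (hz₀ : z₀ ∈ P.XN N) : P.Vinf z₀ < ⊤ := by
  obtain ⟨c, ρ, hc, hρ, hρ1, hr⟩ := h_reach
  obtain ⟨κ, hκ⟩ := abs_stageCost_sub_le h_rci h_cost h_ross
  obtain ⟨z, v, hz, hb⟩ := hr N hN z₀ hz₀
  refine (sInf_le ⟨z, v, hz, rfl⟩ : P.Vinf z₀ ≤ _).trans_lt ?_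
  refine lt_of_le_of_lt ?_ (EReal.coe_lt_top (κ * (c * (1 - ρ)⁻¹)))
  refine limsup_le_of_le (h := Eventually.of_forall fun T => ?_)
  refine EReal.coe_le_coe ?_
  calc P.J T z v ≤ ∑ t ∈ Finset.range T, κ * (c * ρ ^ t) :=
        Finset.sum_le_sum fun t _ => by
          have h1 := (le_abs_self _).trans (hκ _ (hz.2 t).2)
          have h2 := mul_le_mul_of_nonneg_left (hb t) κ.coe_nonneg
          rw [hs] at h1
          linarith
    _ = κ * (c * ∑ t ∈ Finset.range T, ρ ^ t) := by simp only [Finset.mul_sum]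
    _ ≤ κ * (c * (1 - ρ)⁻¹) := by
        gcongr
        rw [← tsum_geometric_of_lt_one hρ hρ1]
        exact (summable_geometric_of_lt_one hρ hρ1).sum_le_tsum _ fun t _ => pow_nonneg hρ t

theorem bot_lt_Vinf (hs : P.ℓ (P.zs, P.vs) = 0)
    {lam : EuclideanSpace ℝ (Fin n) → ℝ} {α : ℝ≥0 → ℝ≥0}
    (h : P.StrictlyDissipative lam α) (z₀ : EuclideanSpace ℝ (Fin n)) : ⊥ < P.Vinf z₀ := by
  obtain ⟨B, hB⟩ := h.2.1
  refine (EReal.bot_lt_coe (-(2 * B))).trans_le (le_sInf ?_)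
  rintro _ ⟨z, v, hz, rfl⟩
  exact hz.neg_two_mul_le_Jinf hs h hB

/-! ### Nonzero steady-state cost, and the closed-loop estimate. -/

/-- A positive steady-state cost makes every infinite trajectory infinitely expensive. -/
theorem Vinf_eq_top (hs : 0 < P.ℓ (P.zs, P.vs))
    {lam : EuclideanSpace ℝ (Fin n) → ℝ} {α : ℝ≥0 → ℝ≥0}
    (h : P.StrictlyDissipative lam α) (z₀ : EuclideanSpace ℝ (Fin n)) : P.Vinf z₀ = ⊤ := by
  obtain ⟨B, hB⟩ := h.2.1
  refine sInf_eq_top.2 ?_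
  rintro _ ⟨z, v, hz, rfl⟩
  have hlim : Tendsto (fun T : ℕ => P.J T z v) atTop atTop := by
    refine tendsto_atTop_mono (f := fun T : ℕ => -(2 * B) + T * P.ℓ (P.zs, P.vs)) (fun T => ?_)
      (tendsto_atTop_add_const_left _ _ (tendsto_natCast_atTop_atTop.atTop_mul_const hs))
    have h1 := (hz.take T).le_J h
    linarith [abs_le.1 (hB (z 0)), abs_le.1 (hB (z T))]
  exact (EReal.tendsto_coe_nhds_top_iff.2 hlim).limsup_eq

/-- A negative steady-state cost makes every closed-loop cost unbounded below. -/
theorem JclInf_eq_bot (h_opt : P.IsOptimalSelection zopt vopt)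
    {ini : ℕ → EuclideanSpace ℝ (Fin n) → EuclideanSpace ℝ (Fin n)}
    (h_ini : P.IsOptimalInitial ini) (h_sets : P.ConstraintSets) (h_rci : P.RCIAssumption)
    (h_term : P.TerminalAssumption) (h_cont : P.ValueContinuity)
    (hs : P.ℓ (P.zs, P.vs) < 0) {N : ℕ} (hN : 1 ≤ N) {z : ℕ → EuclideanSpace ℝ (Fin n)}
    (hz : P.IsClosedLoop vopt ini N z) : P.JclInf vopt N z = ⊥ := by
  obtain ⟨C, -, hV⟩ := exists_V_sub_le h_sets h_rci h_cont
  have hlim : Tendsto (fun T : ℕ => P.J T z (fun t => vopt N (z t) 0)) atTop atBot := by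
    refine tendsto_atBot_mono (g := fun T : ℕ => P.J T z (fun t => vopt N (z t) 0))
      (f := fun T : ℕ => (P.V N (z 0) - P.V N P.zs + C) + T * P.ℓ (P.zs, P.vs)) (fun T => ?_)
      (tendsto_atBot_add_const_left _ _ (tendsto_natCast_atTop_atTop.atTop_mul_const_of_neg hs))
    obtain ⟨h1, h2⟩ := J_closedLoop_le h_opt h_ini h_term hN hz T
    have h3 := abs_le.1 (hV N hN _ h1)
    linarith
  exact (EReal.tendsto_coe_nhds_bot_iff.2 hlim).limsup_eq

/-- The closed-loop cost is at most the decrease of the optimal value down to the steady state. -/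
theorem JclInf_le (h_opt : P.IsOptimalSelection zopt vopt)
    {ini : ℕ → EuclideanSpace ℝ (Fin n) → EuclideanSpace ℝ (Fin n)}
    (h_ini : P.IsOptimalInitial ini) (h_sets : P.ConstraintSets) (h_rci : P.RCIAssumption)
    (h_term : P.TerminalAssumption) {lam : EuclideanSpace ℝ (Fin n) → ℝ} {α : ℝ≥0 → ℝ≥0}
    (h : P.StrictlyDissipative lam α) (h' : P.StronglyDissipative vopt ini lam α)
    (h_cont : P.ValueContinuity) (hs : P.ℓ (P.zs, P.vs) = 0) {N : ℕ} (hN : 1 ≤ N)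
    {z : ℕ → EuclideanSpace ℝ (Fin n)} (hz : P.IsClosedLoop vopt ini N z) :
    P.JclInf vopt N z ≤ ((P.V N (z 0) - P.V N P.zs : ℝ) : EReal) := by
  obtain ⟨C, -, hC⟩ := exists_V_sub_le h_sets h_rci h_cont
  obtain ⟨αV, hαV, hV⟩ := h_cont
  obtain ⟨B, hB⟩ := h.2.1
  have hcl := J_closedLoop_le h_opt h_ini h_term hN hz
  rw [hs] at hcl
  simp only [mul_zero, add_zero] at hcl
  -- The closed loop need not obey the nominal dynamics, so strong dissipativity bounds the
  -- dissipation sums here; the telescoped value decrease supplies the upper bound on `J_T`.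
  have hlim : Tendsto z atTop (𝓝 P.zs) := by
    refine tendsto_of_sum_dissipation_le h.1 (v := fun t => vopt N (z t) 0)
      (P.V N (z 0) - P.V N P.zs + C + 2 * B) fun T => ?_
    have h1 := sum_dissipation (v := fun t => vopt N (z t) 0) lam α T
      fun t _ => h' N hN (z t) (hcl t).1 _ (hz.2 t)
    have h3 := abs_le.1 (hC N hN _ (hcl T).1)
    rw [hs] at h1
    linarith [abs_le.1 (hB (z 0)), abs_le.1 (hB (z T)), (hcl T).2]
  have hα : Tendsto (fun T => (αV ‖z T - P.zs‖₊ : ℝ)) atTop (𝓝 0) := by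
    have h1 : Tendsto (fun T => ‖z T - P.zs‖₊) atTop (𝓝 0) := by
      simpa using (hlim.sub_const P.zs).nnnorm
    have h2 := ((NNReal.continuous_coe.comp hαV.1).tendsto 0).comp h1
    simpa [Function.comp_def, hαV.2.2.1] using h2
  have hbound : Tendsto (fun T => ((P.V N (z 0) - P.V N P.zs + αV ‖z T - P.zs‖₊ : ℝ) : EReal))
      atTop (𝓝 ((P.V N (z 0) - P.V N P.zs : ℝ) : EReal)) := by
    have := hα.const_add (P.V N (z 0) - P.V N P.zs)
    rw [add_zero] at this
    exact EReal.tendsto_coe.2 this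
  rw [← hbound.limsup_eq]
  refine limsup_le_limsup (Eventually.of_forall fun T => ?_)
  refine EReal.coe_le_coe ?_
  have h3 := abs_le.1 (hV N hN _ (hcl T).1)
  linarith [(hcl T).2]

end Performance

end Problem

end TubeEMPC

theorem mainTheorem1 {n m q : ℕ} (P : TubeEMPC.Problem n m q)
    (zopt : ℕ → EuclideanSpace ℝ (Fin n) → ℕ → EuclideanSpace ℝ (Fin n))
    (vopt : ℕ → EuclideanSpace ℝ (Fin n) → ℕ → EuclideanSpace ℝ (Fin m))
    (ini : ℕ → EuclideanSpace ℝ (Fin n) → EuclideanSpace ℝ (Fin n))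
    (h_opt : P.IsOptimalSelection zopt vopt)
    (h_ini : P.IsOptimalInitial ini)
    (h_sets : P.ConstraintSets)
    (h_rci : P.RCIAssumption)
    (h_cost : P.StageCostAssumption)
    (h_term : P.TerminalAssumption)
    (h_ross : P.ROSSAssumption)
    (h_reach : P.ExponentiallyReachable)
    (h_ctrl : P.LocallyControllable)
    (h_diss : P.DissipativityAssumption vopt ini)
    (h_cont : P.ValueContinuity) :
    (∃ δ₁ : ℝ≥0 → ℝ≥0, TubeEMPC.ClassL δ₁ ∧
      ∀ N : ℕ, 1 ≤ N → ∀ z : ℕ → EuclideanSpace ℝ (Fin n),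
        P.IsClosedLoop vopt ini N z →
          P.JclInf vopt N z ≤ P.Vinf (z 0) + (((δ₁ N : ℝ≥0) : ℝ) : EReal)) ∧
    (P.ℓ (P.zs, P.vs) = 0 →
      ∀ N : ℕ, 1 ≤ N → ∀ z₀ ∈ P.XN N, P.Vinf z₀ ≠ ⊤ ∧ P.Vinf z₀ ≠ ⊥) := by
  obtain ⟨lam, α, h, h'⟩ := h_diss
  refine ⟨?_, fun hs N hN z₀ hz₀ =>
    ⟨(TubeEMPC.Problem.Vinf_lt_top h_rci h_cost h_ross h_reach hs hN hz₀).ne,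
      (TubeEMPC.Problem.bot_lt_Vinf hs h z₀).ne'⟩⟩
  rcases lt_trichotomy (P.ℓ (P.zs, P.vs)) 0 with hs | hs | hs
  -- Any `𝓛`-function will do; one is obtained by dominating the zero sequence.
  · obtain ⟨δ, hδ, -⟩ := TubeEMPC.exists_classL_ge (fun _ => 0) 0 (fun _ => le_rfl)
      (fun _ => le_rfl) tendsto_const_nhds
    refine ⟨δ, hδ, fun N hN z hz => ?_⟩
    rw [TubeEMPC.Problem.JclInf_eq_bot h_opt h_ini h_sets h_rci h_term h_cont hs hN hz]
    exact bot_le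
  · obtain ⟨δ, hδ, hV⟩ := TubeEMPC.Problem.exists_classL_V_sub_le_Vinf h_opt h_sets h_rci h_cost
      h_term h_ross h_ctrl h h_cont hs
    exact ⟨δ, hδ, fun N hN z hz => (TubeEMPC.Problem.JclInf_le h_opt h_ini h_sets h_rci h_term h h'
      h_cont hs hN hz).trans (hV N hN _ hz.1)⟩
  · obtain ⟨δ, hδ, -⟩ := TubeEMPC.exists_classL_ge (fun _ => 0) 0 (fun _ => le_rfl)
      (fun _ => le_rfl) tendsto_const_nhds
    refine ⟨δ, hδ, fun N hN z hz => ?_⟩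
    rw [TubeEMPC.Problem.Vinf_eq_top hs h, EReal.top_add_coe]
    exact le_top
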